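/- **Theorem 2.** Fix integers $d_1,d_2\ge 1$, measurable sets $\Omega_1\subset\mathbb R^{d_1}$, $\Omega_2\subset\mathbb R^{d_2}$ and a real $\alpha\ge1$. All of the following may depend on the sample size $N\in\mathbb N$, and all asymptotic statements are for $N\to\infty$. For $A\in L_2(\Omega_1\times\Omega_2)$ write $A[u,v]=\iint A(x,y)u(x)v(y)\,dx\,dy$, and for a bilinear form $B$ on $L_2(\Omega_1)\times L_2(\Omega_2)$ and finite-dimensional subspaces $\mathcal M\subset L_2(\Omega_1)$, $\mathcal L\subset L_2(\Omega_2)$ with orthogonal projections $\mathcal P_{\mathcal M},\mathcal P_{\mathcal L}$ let $(B\times_x\mathcal P_{\mathcal M}\times_y\mathcal P_{\mathcal L})[u,v]=B[\mathcal P_{\mathcal M}u,\mathcal P_{\mathcal L}v]$, $(B\times_y\mathcal P_{\mathcal L})[u,v]=B[u,\mathcal P_{\mathcal L}v]$ and $\|B\|_{\rm op}=\sup_{\|u\|,\|v\|\le1}B[u,v]$; if $A\in L_2(\Omega_1\times\Omega_2)$, then $A\times_y\mathcal P_{\mathcal L}$ and $A\times_x\mathcal P_{\mathcal M}\times_y\mathcal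 P_{\mathcal L}$ are again functions in $L_2(\Omega_1\times\Omega_2)$. Write $X_N=O_{\mathbb P}(a_N)$ if for every $\epsilon>0$ there is $K_\epsilon>0$ with $\limsup_{N\to\infty}\mathbb P(|X_N/a_N|\ge K_\epsilon)<\epsilon$. 1. (Low rank.) $A^*\in L_2(\Omega_1\times\Omega_2)$ and $A^*(x,y)=\sum_{\rho=1}^r\sigma_\rho\Phi^*_\rho(x)\Psi^*_\rho(y)$, where $r\ge1$, $\sigma_1\ge\dots\ge\sigma_r>0$, and $\{\Phi^*_\rho\}\subset L_2(\Omega_1)$, $\{\Psi^*_\rho\}\subset L_2(\Omega_2)$ are orthonormal. 2. (Bias.) $\mathcal M\subset L_2(\Omega_1)$ and $\mathcal L\subset L_2(\Omega_2)$ are linear subspaces with $\dim\mathcal M=m^{d_1}$, $\dim\mathcal L=l^{d_2}$, where $m,l\ge1$ are integers, and $$\|A^*-A^*\times_x\mathcal P_{\mathcal M}\times_y\mathcal P_{\mathcal L}\|_{L_2}^2=O(m^{-2\alpha}+l^{-2\alpha}),\quad \|A^*-A^*\times_y\mathcal P_{\mathcal L}\|_{L_2}^2=O(l^{-2\alpha}),\quad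 \|A^*\times_y\mathcal P_{\mathcal L}-A^*\times_x\mathcal P_{\mathcal M}\times_y\mathcal P_{\mathcal L}\|_{L_2}^2=O(m^{-2\alpha}).$$ 3. (Sample deviation.) $\widehat A$ is an estimator formed from a sample of size $N$, given by its random values $\widehat A[u,v]$, bilinear in $u\in L_2(\Omega_1)$ and $v\in L_2(\Omega_2)$ (for example a random function in $L_2(\Omega_1\times\Omega_2)$), and $$\|(\widehat A-A^*)\times_x\mathcal P_{\mathcal M}\times_y\mathcal P_{\mathcal L}\|_{\rm op}=O_{\mathbb P}\Big(\sqrt{\tfrac{\dim\mathcal M+\dim\mathcal L}{N}}\Big).$$ 4. (Signal strength.) For all large $N$, $$\sigma_r>C\max\Big\{l^{-\alpha},\,m^{-\alpha},\,\sqrt{\tfrac{m^{d_1}+l^{d_2}}{N}}\Big\}$$ for a sufficiently large constant $C$, depending only on the constant implied in the bias bounds in 2. Let $\mathcal P^*_x$ be the orthogonal projection of $L_2(\Omega_1)$ onto $\mathrm{Range}_x(A^*)=\mathrm{span}\{\Phi_1^*,\dots,\Phi_r^*\}$, and let $\widehat{\mathcal P}_x$ be the orthogonal projection onto the span of the leading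 $r$ singular functions in the variable $x$ of $\widehat A\times_x\mathcal P_{\mathcal M}\times_y\mathcal P_{\mathcal L}$ (for any choice of a singular value decomposition). Then $$\|\widehat{\mathcal P}_x-\mathcal P^*_x\|_{\rm op}^2=O_{\mathbb P}\Big\{\sigma_r^{-2}\Big(\frac{m^{d_1}+l^{d_2}}{N}+m^{-2\alpha}\Big)\Big\}.$$ -/

import Mathlib

open MeasureTheory Filter Asymptotics
open scoped ENNReal

noncomputable section

/-- `L₂(Ω)` for a set `Ω ⊆ ℝ^d`, with Lebesgue measure. -/
abbrev L2 {d : ℕ} (Ω : Set (EuclideanSpace ℝ (Fin d))) : Type :=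
  Lp ℝ 2 (volume.restrict Ω)

/-- `L₂(Ω₁ × Ω₂)`, with Lebesgue measure. -/
abbrev L2Prod {d₁ d₂ : ℕ} (Ω₁ : Set (EuclideanSpace ℝ (Fin d₁)))
    (Ω₂ : Set (EuclideanSpace ℝ (Fin d₂))) : Type :=
  Lp ℝ 2 ((volume.restrict Ω₁).prod (volume.restrict Ω₂))

/-- Bilinear forms `(u, v) ↦ A[u, v]` on `L₂(Ω₁) × L₂(Ω₂)`. -/
abbrev Form {d₁ d₂ : ℕ} (Ω₁ : Set (EuclideanSpace ℝ (Fin d₁)))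
    (Ω₂ : Set (EuclideanSpace ℝ (Fin d₂))) : Type :=
  L2 Ω₁ →ₗ[ℝ] L2 Ω₂ →ₗ[ℝ] ℝ

section Tensors

variable {d₁ d₂ : ℕ} {Ω₁ : Set (EuclideanSpace ℝ (Fin d₁))} {Ω₂ : Set (EuclideanSpace ℝ (Fin d₂))}

theorem eLpNorm_tensor (u : L2 Ω₁) (v : L2 Ω₂) :
    eLpNorm (fun z : EuclideanSpace ℝ (Fin d₁) × EuclideanSpace ℝ (Fin d₂) => u z.1 * v z.2) 2
        ((volume.restrict Ω₁).prod (volume.restrict Ω₂)) =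
      eLpNorm u 2 (volume.restrict Ω₁) * eLpNorm v 2 (volume.restrict Ω₂) := by
  rw [eLpNorm_eq_lintegral_rpow_enorm_toReal (by simp) (by simp),
    eLpNorm_eq_lintegral_rpow_enorm_toReal (by simp) (by simp),
    eLpNorm_eq_lintegral_rpow_enorm_toReal (by simp) (by simp)]
  rw [← ENNReal.mul_rpow_of_nonneg _ _ (by positivity)]
  congr 1
  rw [← lintegral_prod_mul
    ((Lp.aestronglyMeasurable u).enorm.pow_const _)
    ((Lp.aestronglyMeasurable v).enorm.pow_const _)]
  refine lintegral_congr fun z => ?_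
  rw [enorm_mul, ENNReal.mul_rpow_of_nonneg _ _ (by positivity)]

theorem memLp_tensor (u : L2 Ω₁) (v : L2 Ω₂) :
    MemLp (fun z : EuclideanSpace ℝ (Fin d₁) × EuclideanSpace ℝ (Fin d₂) => u z.1 * v z.2) 2
      ((volume.restrict Ω₁).prod (volume.restrict Ω₂)) := by
  refine ⟨(Lp.aestronglyMeasurable u).comp_fst.mul (Lp.aestronglyMeasurable v).comp_snd, ?_⟩
  rw [eLpNorm_tensor]
  exact ENNReal.mul_lt_top (Lp.memLp u).2 (Lp.memLp v).2

/-- The function `u ⊗ v : (x, y) ↦ u(x) v(y)` in `L₂(Ω₁ × Ω₂)`. -/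
def tensor (u : L2 Ω₁) (v : L2 Ω₂) : L2Prod Ω₁ Ω₂ :=
  (memLp_tensor u v).toLp _

theorem norm_tensor (u : L2 Ω₁) (v : L2 Ω₂) : ‖tensor u v‖ = ‖u‖ * ‖v‖ := by
  rw [tensor, Lp.norm_toLp, eLpNorm_tensor, ENNReal.toReal_mul, Lp.norm_def, Lp.norm_def]

theorem tensor_coe (u : L2 Ω₁) (v : L2 Ω₂) :
    tensor u v =ᵐ[(volume.restrict Ω₁).prod (volume.restrict Ω₂)] fun z => u z.1 * v z.2 :=
  MemLp.coeFn_toLp _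

/-- `(u, v) ↦ u ⊗ v` as a bounded bilinear map. -/
def tensorL : L2 Ω₁ →L[ℝ] L2 Ω₂ →L[ℝ] L2Prod Ω₁ Ω₂ :=
  LinearMap.mkContinuous₂
    (LinearMap.mk₂ ℝ tensor
      (by
        intro u u' v
        apply Lp.ext
        filter_upwards [tensor_coe (u + u') v, tensor_coe u v, tensor_coe u' v,
          Lp.coeFn_add (tensor u v) (tensor u' v),
          Measure.quasiMeasurePreserving_fst.ae (Lp.coeFn_add u u')] with z h1 h2 h3 h4 h5
        rw [h1, h4, Pi.add_apply, h2, h3, h5, Pi.add_apply, add_mul])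
      (by
        intro c u v
        apply Lp.ext
        filter_upwards [tensor_coe (c • u) v, tensor_coe u v, Lp.coeFn_smul c (tensor u v),
          Measure.quasiMeasurePreserving_fst.ae (Lp.coeFn_smul c u)] with z h1 h2 h4 h5
        rw [h1, h4, Pi.smul_apply, h2, h5, Pi.smul_apply, smul_eq_mul, smul_eq_mul, mul_assoc])
      (by
        intro u v v'
        apply Lp.ext
        filter_upwards [tensor_coe u (v + v'), tensor_coe u v, tensor_coe u v',
          Lp.coeFn_add (tensor u v) (tensor u v'),
          Measure.quasiMeasurePreserving_snd.ae (Lp.coeFn_add v v')] with z h1 h2 h3 h4 h5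
        rw [h1, h4, Pi.add_apply, h2, h3, h5, Pi.add_apply, mul_add])
      (by
        intro c u v
        apply Lp.ext
        filter_upwards [tensor_coe u (c • v), tensor_coe u v, Lp.coeFn_smul c (tensor u v),
          Measure.quasiMeasurePreserving_snd.ae (Lp.coeFn_smul c v)] with z h1 h2 h4 h5
        rw [h1, h4, Pi.smul_apply, h2, h5, Pi.smul_apply, smul_eq_mul, smul_eq_mul,
          mul_left_comm]))
    1 (by intro u v; simp [norm_tensor])

theorem tensorL_apply (u : L2 Ω₁) (v : L2 Ω₂) : tensorL u v = tensor u v := rfl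

/-- The bilinear form `A[u, v] = ⟨A, u ⊗ v⟩ = ∬ A(x, y) u(x) v(y) dx dy` of `A ∈ L₂(Ω₁ × Ω₂)`. -/
def toForm (A : L2Prod Ω₁ Ω₂) : Form Ω₁ Ω₂ :=
  LinearMap.mk₂ ℝ (fun u v => inner ℝ A (tensorL u v))
    (by intro u u' v; simp [inner_add_right])
    (by intro c u v; simp [inner_smul_right])
    (by intro u v v'; simp [inner_add_right])
    (by intro c u v; simp [inner_smul_right])

theorem toForm_apply (A : L2Prod Ω₁ Ω₂) (u : L2 Ω₁) (v : L2 Ω₂) :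
    toForm A u v = inner ℝ A (tensor u v) := rfl

theorem toForm_eq_integral (A : L2Prod Ω₁ Ω₂) (u : L2 Ω₁) (v : L2 Ω₂) :
    toForm A u v =
      ∫ z, A z * (u z.1 * v z.2) ∂((volume.restrict Ω₁).prod (volume.restrict Ω₂)) := by
  rw [toForm_apply, L2.inner_def]
  refine integral_congr_ae ?_
  filter_upwards [tensor_coe u v] with z hz
  rw [hz]
  simp [mul_comm]

theorem inner_tensor_tensor (u u' : L2 Ω₁) (v v' : L2 Ω₂) :
    inner ℝ (tensor u v) (tensor u' v') = inner ℝ u u' * inner ℝ v v' := by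
  rw [L2.inner_def, L2.inner_def, L2.inner_def, ← integral_prod_mul]
  refine integral_congr_ae ?_
  filter_upwards [tensor_coe u v, tensor_coe u' v'] with z h1 h2
  rw [h1, h2]
  simp only [RCLike.inner_apply, conj_trivial]
  ring

/-- The bilinear form `(B ×ₓ P ×_y Q)[u, v] = B[P u, Q v]`. -/
def Form.comp (B : Form Ω₁ Ω₂) (P : L2 Ω₁ →L[ℝ] L2 Ω₁) (Q : L2 Ω₂ →L[ℝ] L2 Ω₂) : Form Ω₁ Ω₂ :=
  LinearMap.compl₁₂ B P.toLinearMap Q.toLinearMap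

/-- The operator norm `sup {B[u, v] : ‖u‖ ≤ 1, ‖v‖ ≤ 1}` of a bilinear form. It is used only
for forms `B ×ₓ P_M ×_y P_L` with `M` and `L` finite-dimensional, which are bounded. -/
def Form.opNorm (B : Form Ω₁ Ω₂) : ℝ :=
  sSup {t : ℝ | ∃ (u : L2 Ω₁) (v : L2 Ω₂), ‖u‖ ≤ 1 ∧ ‖v‖ ≤ 1 ∧ t = B u v}

/-- The function `x ↦ ∫_{Ω₂} A(x, y) w(y) dy` in `L₂(Ω₁)`, as the adjoint of `u ↦ u ⊗ w` applied
to `A`; see `inner_contractY` and `contractY_ae_eq`. -/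
def contractY (A : L2Prod Ω₁ Ω₂) (w : L2 Ω₂) : L2 Ω₁ :=
  ContinuousLinearMap.adjoint (tensorL.flip w) A

theorem inner_contractY (A : L2Prod Ω₁ Ω₂) (w : L2 Ω₂) (u : L2 Ω₁) :
    inner ℝ (contractY A w) u = toForm A u w := by
  rw [contractY, ContinuousLinearMap.adjoint_inner_left]
  rfl

theorem contractY_ae_eq (A : L2Prod Ω₁ Ω₂) (w : L2 Ω₂) :
    contractY A w =ᵐ[volume.restrict Ω₁] fun x => ∫ y, A (x, y) * w y ∂(volume.restrict Ω₂) := by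
  have key : ∀ s : Set (EuclideanSpace ℝ (Fin d₁)), MeasurableSet s →
      volume.restrict Ω₁ s < ∞ →
      Integrable (fun z : EuclideanSpace ℝ (Fin d₁) × EuclideanSpace ℝ (Fin d₂) =>
        s.indicator (fun x => A (x, z.2) * w z.2) z.1)
        ((volume.restrict Ω₁).prod (volume.restrict Ω₂)) ∧
      ∫ x in s, contractY A w x ∂(volume.restrict Ω₁) =
        ∫ z, s.indicator (fun x => A (x, z.2) * w z.2) z.1
          ∂((volume.restrict Ω₁).prod (volume.restrict Ω₂)) := by
    intro s hs hμs
    set u : L2 Ω₁ := indicatorConstLp 2 hs hμs.ne (1 : ℝ) with hu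
    have h1 : (fun z => A z * tensor u w z) =ᵐ[(volume.restrict Ω₁).prod (volume.restrict Ω₂)]
        fun z => s.indicator (fun x => A (x, z.2) * w z.2) z.1 := by
      filter_upwards [tensor_coe u w, Measure.quasiMeasurePreserving_fst.ae
        (indicatorConstLp_coeFn (p := 2) (hs := hs) (hμs := hμs.ne) (c := (1 : ℝ)))] with z h2 h3
      rw [h2, hu, h3]
      by_cases hz : z.1 ∈ s <;> simp [hz]
    refine ⟨((Lp.memLp A).integrable_mul (Lp.memLp (tensor u w))).congr h1, ?_⟩
    rw [← integral_congr_ae h1]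
    have h4 := inner_contractY A w u
    rw [toForm_apply, real_inner_comm, hu, L2.inner_indicatorConstLp_one, L2.inner_def] at h4
    rw [h4]
    refine integral_congr_ae (Eventually.of_forall fun z => ?_)
    simp [mul_comm, hu]
  have slice : ∀ (s : Set (EuclideanSpace ℝ (Fin d₁))),
      (fun x => ∫ y, s.indicator (fun x => A (x, y) * w y) x ∂(volume.restrict Ω₂)) =
        s.indicator fun x => ∫ y, A (x, y) * w y ∂(volume.restrict Ω₂) := by
    intro s
    ext x
    by_cases hx : x ∈ s <;> simp [hx]
  refine ae_eq_of_forall_setIntegral_eq_of_sigmaFinite ?_ ?_ ?_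
  · intro s hs hμs
    exact integrableOn_Lp_of_measure_ne_top _ (by norm_num) hμs.ne
  · intro s hs hμs
    have := (key s hs hμs).1.integral_prod_left
    simp only [slice] at this
    exact (integrable_indicator_iff hs).1 this
  · intro s hs hμs
    rw [(key s hs hμs).2, integral_prod _ (key s hs hμs).1]
    simp only [slice]
    rw [integral_indicator hs]

/-- The function `A ×_y P_L = ∑_η (∫ A(x, y') w_η(y') dy') w_η(y)` in `L₂(Ω₁ × Ω₂)`, where
`(w_η)` is an orthonormal basis of `L` (the choice is irrelevant by `toForm_projY`). -/
def projY (A : L2Prod Ω₁ Ω₂) (L : Submodule ℝ (L2 Ω₂)) [FiniteDimensional ℝ L] : L2Prod Ω₁ Ω₂ :=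
  ∑ η, tensor (contractY A (stdOrthonormalBasis ℝ L η : L2 Ω₂)) (stdOrthonormalBasis ℝ L η : L2 Ω₂)

/-- The function `A ×ₓ P_M ×_y P_L = ∑_{μ, η} A[v_μ, w_η] v_μ(x) w_η(y)` in `L₂(Ω₁ × Ω₂)`, where
`(v_μ)` and `(w_η)` are orthonormal bases of `M` and `L` (the choice is irrelevant by
`toForm_projXY`). -/
def projXY (A : L2Prod Ω₁ Ω₂) (M : Submodule ℝ (L2 Ω₁)) [FiniteDimensional ℝ M]
    (L : Submodule ℝ (L2 Ω₂)) [FiniteDimensional ℝ L] : L2Prod Ω₁ Ω₂ :=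
  ∑ μ, ∑ η, toForm A (stdOrthonormalBasis ℝ M μ : L2 Ω₁) (stdOrthonormalBasis ℝ L η : L2 Ω₂) •
    tensor (stdOrthonormalBasis ℝ M μ : L2 Ω₁) (stdOrthonormalBasis ℝ L η : L2 Ω₂)

theorem starProjection_eq_sum {H : Type*} [NormedAddCommGroup H] [InnerProductSpace ℝ H]
    (U : Submodule ℝ H) [FiniteDimensional ℝ U] (x : H) :
    U.starProjection x =
      ∑ i, inner ℝ (stdOrthonormalBasis ℝ U i : H) x • (stdOrthonormalBasis ℝ U i : H) := by
  rw [(stdOrthonormalBasis ℝ U).starProjection_eq_sum_rankOne]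
  simp

theorem toForm_projY (A : L2Prod Ω₁ Ω₂) (L : Submodule ℝ (L2 Ω₂)) [FiniteDimensional ℝ L]
    (u : L2 Ω₁) (v : L2 Ω₂) : toForm (projY A L) u v = toForm A u (L.starProjection v) := by
  rw [starProjection_eq_sum, toForm_apply, projY, sum_inner, map_sum]
  refine Finset.sum_congr rfl fun η _ => ?_
  rw [inner_tensor_tensor, inner_contractY, map_smul, smul_eq_mul, mul_comm]

theorem toForm_projXY (A : L2Prod Ω₁ Ω₂) (M : Submodule ℝ (L2 Ω₁)) [FiniteDimensional ℝ M]
    (L : Submodule ℝ (L2 Ω₂)) [FiniteDimensional ℝ L] (u : L2 Ω₁) (v : L2 Ω₂) :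
    toForm (projXY A M L) u v = toForm A (M.starProjection u) (L.starProjection v) := by
  rw [starProjection_eq_sum M, map_sum, LinearMap.sum_apply, toForm_apply, projXY, sum_inner]
  refine Finset.sum_congr rfl fun μ _ => ?_
  rw [starProjection_eq_sum L, map_sum, sum_inner]
  refine Finset.sum_congr rfl fun η _ => ?_
  rw [real_inner_smul_left, inner_tensor_tensor, map_smul, map_smul, LinearMap.smul_apply,
    smul_eq_mul, smul_eq_mul]
  ring

/-- `B = ∑_{i < n} s_i u_i ⊗ v_i` is a (finite) singular value decomposition of the form `B`:
non-increasing, nonnegative `s_i`, orthonormal `u_i` and orthonormal `v_i`. -/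
structure IsSVD (B : Form Ω₁ Ω₂) {n : ℕ} (s : Fin n → ℝ) (u : Fin n → L2 Ω₁)
    (v : Fin n → L2 Ω₂) : Prop where
  antitone : Antitone s
  nonneg : ∀ i, 0 ≤ s i
  orthonormal_left : Orthonormal ℝ u
  orthonormal_right : Orthonormal ℝ v
  eq_sum : ∀ f g, B f g = ∑ i, s i * (inner ℝ (u i) f * inner ℝ (v i) g)

/-- The orthogonal projection of `L₂(Ω)` onto the span of finitely many functions. -/
def projSpan {d : ℕ} {Ω : Set (EuclideanSpace ℝ (Fin d))} {ι : Type} [Finite ι]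
    (u : ι → L2 Ω) : L2 Ω →L[ℝ] L2 Ω :=
  haveI : FiniteDimensional ℝ (Submodule.span ℝ (Set.range u)) :=
    FiniteDimensional.span_of_finite ℝ (Set.finite_range u)
  (Submodule.span ℝ (Set.range u)).starProjection

/-- `P` is the orthogonal projection onto the span of the leading `r` singular functions in the
variable `x` of the finite-rank form `B`, for some choice of a singular value decomposition
(which is not unique if singular values are tied). If the rank of `B` is smaller than `r`, both
the span of all singular functions and a completion by singular functions with singular value
zero are admitted. -/
def IsLeadingProjection (B : Form Ω₁ Ω₂) (r : ℕ) (P : L2 Ω₁ →L[ℝ] L2 Ω₁) : Prop :=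
  ∃ (n : ℕ) (s : Fin n → ℝ) (u : Fin n → L2 Ω₁) (v : Fin n → L2 Ω₂),
    IsSVD B s u v ∧ P = projSpan (fun i : {i : Fin n // (i : ℕ) < r} => u i)

end Tensors

/-- `X_N = O_P(a_N)` as `N → ∞`: for every `ε > 0` there is `K > 0` such that
`limsup_N P(|X_N / a_N| ≥ K) < ε`. (A measure in Lean is defined on all sets, as the outer
measure, so that no measurability is needed here.) -/
def IsBigOP {Ξ : ℕ → Type*} [∀ N, MeasurableSpace (Ξ N)] (P : ∀ N, Measure (Ξ N))
    (X : ∀ N, Ξ N → ℝ) (a : ℕ → ℝ) : Prop :=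
  ∀ ε : ℝ, 0 < ε → ∃ K : ℝ, 0 < K ∧
    limsup (fun N => P N {ω | K ≤ |X N ω / a N|}) atTop < ENNReal.ofReal ε

end

/-!
Write `A_L` for `A ×_y P_L`. The projection `Phat` is compared with the range in `x` of `A_L` instead
of that of `A`: the two ranges agree as soon as the bias in `y` is below the smallest singular value
`σ_r`, which the signal condition with `C = 2 √B` ensures; moreover `σ_r(A_L) ≥ σ_r / 2`
(`le_norm_partialMap`). So the bias in `y` enters only through a constant factor. The form
`Ahat ×ₓ P_M ×_y P_L` is a perturbation of `A_L` by the sample deviation on `M` and `L` plus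
`A_L ×ₓ P_M - A_L`, which is the bias in `x`.

Let `S : u ↦ A_L[u, ·]`, let `U` be the span of the `Φ_ρ` and `δ` the size of the perturbation. Then
`S` vanishes on `Uᗮ` and expands by at least `τ = σ_r / 2` on `U`. Weyl's inequalities show that the
leading `r` singular values of the perturbed map are at least `τ - δ`, the others at most `δ`
(`sub_le_singularValue`, `singularValue_le`). If `δ ≤ τ / 2`, a vector `f ⊥ U` is mapped by the
perturbed map to a vector of norm at most `δ ‖f‖`, so that its projection to the leading singular
space has norm at most `2 δ ‖f‖ / τ`; a vector `f` orthogonal to the leading singular space is mapped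
by `S` to a vector of norm at most `2 δ ‖f‖`, so that its projection to `U` obeys the same bound. Hence
`‖Phat - P*‖ ≤ 4 δ / τ` (`norm_starProjection_span_sub_le`), which is trivially true for `δ > τ / 2`.
As this holds for every sample, the stochastic order follows from that of the deviation by inclusion
of events (`IsBigOP.of_eventually`), without a comparison of `C` and the constants of the deviation.
-/

/-! ### Perturbation of singular spaces in Hilbert spaces -/

section Hilbert

variable {E F : Type*} [NormedAddCommGroup E] [InnerProductSpace ℝ E]
  [NormedAddCommGroup F] [InnerProductSpace ℝ F]

theorem Orthonormal.norm_sum_smul_sq {ι : Type*} [Fintype ι] {v : ι → F} (hv : Orthonormal ℝ v)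
    (c : ι → ℝ) : ‖∑ i, c i • v i‖ ^ 2 = ∑ i, c i ^ 2 := by
  rw [← real_inner_self_eq_norm_sq, hv.inner_sum]
  exact Finset.sum_congr rfl fun i _ => by simp [sq]

theorem Orthonormal.sum_inner_sq_le {ι : Type*} [Fintype ι] {u : ι → E} (hu : Orthonormal ℝ u)
    (f : E) : ∑ i, inner ℝ (u i) f ^ 2 ≤ ‖f‖ ^ 2 := by
  have h := hu.sum_inner_products_le f (s := Finset.univ)
  simpa [Real.norm_eq_abs, sq_abs] using h

theorem Orthonormal.starProjection_span_eq_sum {ι : Type*} [Fintype ι] {u : ι → E}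
    (hu : Orthonormal ℝ u) [(Submodule.span ℝ (Set.range u)).HasOrthogonalProjection] (f : E) :
    (Submodule.span ℝ (Set.range u)).starProjection f = ∑ i, inner ℝ (u i) f • u i := by
  refine Submodule.eq_starProjection_of_mem_of_inner_eq_zero ?_ ?_
  · exact Submodule.sum_mem _ fun i _ =>
      Submodule.smul_mem _ _ (Submodule.subset_span (Set.mem_range_self i))
  · intro w hw
    induction hw using Submodule.span_induction with
    | mem x hx =>
      obtain ⟨i, rfl⟩ := hx
      rw [real_inner_comm, inner_sub_right, hu.inner_right_fintype, sub_self]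
    | zero => simp
    | add x y _ _ hx hy => rw [inner_add_right, hx, hy, add_zero]
    | smul c x _ hx => rw [inner_smul_right, hx, mul_zero]

/-- A subspace of dimension larger than the number of linear conditions `⟨w i, x⟩ = 0` contains a
nonzero solution. -/
theorem exists_ne_zero_forall_inner_eq_zero (U : Submodule ℝ E) [FiniteDimensional ℝ U]
    {ι : Type*} [Fintype ι] (w : ι → E) (h : Fintype.card ι < Module.finrank ℝ U) :
    ∃ x ∈ U, x ≠ 0 ∧ ∀ i, inner ℝ (w i) x = 0 := by
  let T : U →ₗ[ℝ] (ι → ℝ) :=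
    LinearMap.pi fun i => (innerSL ℝ (w i)).toLinearMap ∘ₗ U.subtype
  have hT : LinearMap.ker T ≠ ⊥ := LinearMap.ker_ne_bot_of_finrank_lt (by simpa using h)
  obtain ⟨x, hx, hx0⟩ := Submodule.exists_mem_ne_zero_of_ne_bot hT
  refine ⟨x, x.2, by simpa using hx0, fun i => ?_⟩
  exact congrFun (LinearMap.mem_ker.1 hx) i

theorem norm_le_of_forall_inner_le {x : E} {c : ℝ} (hc : 0 ≤ c)
    (h : ∀ g, inner ℝ x g ≤ c * ‖g‖) : ‖x‖ ≤ c := by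
  rcases (norm_nonneg x).eq_or_lt with hx | hx
  · rwa [← hx]
  · have := h x
    rw [real_inner_self_eq_norm_mul_norm] at this
    exact le_of_mul_le_mul_right this hx

section SVD

variable {n : ℕ} {s : Fin n → ℝ} {u : Fin n → E} {v : Fin n → F}

theorem norm_svd_sq (hv : Orthonormal ℝ v) (f : E) :
    ‖∑ i, (s i * inner ℝ (u i) f) • v i‖ ^ 2 = ∑ i, s i ^ 2 * inner ℝ (u i) f ^ 2 := by
  rw [hv.norm_sum_smul_sq]
  exact Finset.sum_congr rfl fun i _ => mul_pow _ _ _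

theorem norm_svd_le (hs : ∀ i, 0 ≤ s i) (hu : Orthonormal ℝ u) (hv : Orthonormal ℝ v)
    {f : E} {c : ℝ} (hc : 0 ≤ c) (h : ∀ i, inner ℝ (u i) f = 0 ∨ s i ≤ c) :
    ‖∑ i, (s i * inner ℝ (u i) f) • v i‖ ≤ c * ‖f‖ := by
  refine le_of_sq_le_sq ?_ (by positivity)
  rw [norm_svd_sq hv, mul_pow]
  calc ∑ i, s i ^ 2 * inner ℝ (u i) f ^ 2 ≤ ∑ i, c ^ 2 * inner ℝ (u i) f ^ 2 := by
        refine Finset.sum_le_sum fun i _ => ?_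
        rcases h i with h | h
        · simp [h]
        · have := hs i
          gcongr
    _ ≤ c ^ 2 * ‖f‖ ^ 2 := by
        rw [← Finset.mul_sum]
        exact mul_le_mul_of_nonneg_left (hu.sum_inner_sq_le f) (sq_nonneg c)

variable {U : Submodule ℝ E} [FiniteDimensional ℝ U] {S : E →ₗ[ℝ] F} {τ δ : ℝ}

/-- Weyl's lower bound: on `U ∩ {u₀, …, uᵢ₋₁}ᗮ ≠ 0` the map `S` expands by `τ`, while the
decomposed map expands at most by `sᵢ`. -/
theorem sub_le_singularValue (hs : Antitone s) (hs0 : ∀ i, 0 ≤ s i) (hu : Orthonormal ℝ u)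
    (hv : Orthonormal ℝ v) (hS : ∀ f ∈ U, τ * ‖f‖ ≤ ‖S f‖)
    (hE : ∀ f, ‖∑ i, (s i * inner ℝ (u i) f) • v i - S f‖ ≤ δ * ‖f‖)
    (i : Fin n) (hi : (i : ℕ) < Module.finrank ℝ U) : τ - δ ≤ s i := by
  obtain ⟨x, hxU, hx0, hx⟩ := exists_ne_zero_forall_inner_eq_zero U
    (fun j : Fin i => u (Fin.castLE i.2.le j)) (by simpa using hi)
  have h1 := norm_svd_le hs0 hu hv (f := x) (hs0 i) fun j => by
    by_cases hj : j < i
    · exact Or.inl (hx ⟨j, hj⟩)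
    · exact Or.inr (hs (not_lt.1 hj))
  have h2 := norm_sub_norm_le (S x) (∑ i, (s i * inner ℝ (u i) x) • v i)
  rw [norm_sub_rev] at h2
  refine le_of_mul_le_mul_right ?_ (norm_pos_iff.2 hx0)
  linarith [hS x hxU, hE x]

/-- Weyl's upper bound: `span {u₀, …, uᵢ}` meets `Uᗮ`, where `S` vanishes, and there the
decomposed map expands at least by `sᵢ`. -/
theorem singularValue_le (hs : Antitone s) (hs0 : ∀ i, 0 ≤ s i) (hu : Orthonormal ℝ u)
    (hv : Orthonormal ℝ v) (hU : ∀ f ∈ Uᗮ, S f = 0)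
    (hE : ∀ f, ‖∑ i, (s i * inner ℝ (u i) f) • v i - S f‖ ≤ δ * ‖f‖)
    (i : Fin n) (hi : Module.finrank ℝ U ≤ i) : s i ≤ δ := by
  let w : Fin (i + 1) → E := fun j => u (Fin.castLE i.2 j)
  have hw : Orthonormal ℝ w := hu.comp _ (Fin.castLE_injective _)
  have : FiniteDimensional ℝ (Submodule.span ℝ (Set.range w)) :=
    FiniteDimensional.span_of_finite ℝ (Set.finite_range w)
  obtain ⟨x, hxw, hx0, hx⟩ := exists_ne_zero_forall_inner_eq_zero (Submodule.span ℝ (Set.range w))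
    (fun j => (stdOrthonormalBasis ℝ U j : E)) (by
      rw [finrank_span_eq_card hw.linearIndependent]
      simpa using Nat.lt_succ_of_le hi)
  have hxU : x ∈ Uᗮ := by
    rw [← Submodule.starProjection_apply_eq_zero_iff, starProjection_eq_sum]
    simp [hx]
  have h1 : s i * ‖x‖ ≤ ‖∑ i, (s i * inner ℝ (u i) x) • v i‖ := by
    refine le_of_sq_le_sq ?_ (norm_nonneg _)
    have hx' := hw.starProjection_span_eq_sum x
    rw [Submodule.starProjection_eq_self_iff.2 hxw] at hx'
    have hn : ‖x‖ ^ 2 = ∑ j, inner ℝ (w j) x ^ 2 := by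
      conv_lhs => rw [hx']
      exact hw.norm_sum_smul_sq _
    rw [norm_svd_sq hv, mul_pow, hn, Finset.mul_sum]
    calc ∑ j, s i ^ 2 * inner ℝ (w j) x ^ 2
        ≤ ∑ j, s (Fin.castLE i.2 j) ^ 2 * inner ℝ (u (Fin.castLE i.2 j)) x ^ 2 := by
          refine Finset.sum_le_sum fun j _ => ?_
          have : s i ≤ s (Fin.castLE i.2 j) := hs (Nat.lt_succ_iff.1 j.2)
          have := hs0 i
          gcongr
      _ = ∑ k ∈ Finset.univ.map (Fin.castLEEmb i.2), s k ^ 2 * inner ℝ (u k) x ^ 2 := by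
          simp
      _ ≤ ∑ k, s k ^ 2 * inner ℝ (u k) x ^ 2 :=
          Finset.sum_le_sum_of_subset_of_nonneg (Finset.subset_univ _) fun k _ _ => by positivity
  have h2 := hE x
  rw [hU x hxU, sub_zero] at h2
  exact le_of_mul_le_mul_right (h1.trans h2) (norm_pos_iff.2 hx0)

/-- A one-sided form of Wedin's theorem: if `S` vanishes on `Uᗮ` and expands by at least `τ` on
`U`, and a map with the given singular value decomposition differs from `S` by at most `δ`, then
the span of its leading `dim U` right singular vectors `uᵢ` is within `4 δ / τ` of `U`. -/
theorem norm_starProjection_span_sub_le (hs : Antitone s) (hs0 : ∀ i, 0 ≤ s i)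
    (hu : Orthonormal ℝ u) (hv : Orthonormal ℝ v) (hU : ∀ f ∈ Uᗮ, S f = 0) (hτ : 0 < τ)
    (hδ : 0 ≤ δ) (hS : ∀ f ∈ U, τ * ‖f‖ ≤ ‖S f‖)
    (hE : ∀ f, ‖∑ i, (s i * inner ℝ (u i) f) • v i - S f‖ ≤ δ * ‖f‖) {r : ℕ}
    (hr : Module.finrank ℝ U = r)
    [(Submodule.span ℝ (Set.range fun i : {i : Fin n // (i : ℕ) < r} =>
      u i)).HasOrthogonalProjection] :
    ‖(Submodule.span ℝ (Set.range fun i : {i : Fin n // (i : ℕ) < r} => u i)).starProjection -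
      U.starProjection‖ ≤ 4 * δ / τ := by
  subst hr
  set V := Submodule.span ℝ
    (Set.range fun i : {i : Fin n // (i : ℕ) < Module.finrank ℝ U} => u i) with hV
  have hw : Orthonormal ℝ fun i : {i : Fin n // (i : ℕ) < Module.finrank ℝ U} => u i :=
    hu.comp _ Subtype.val_injective
  rcases lt_or_ge (τ / 2) δ with h | h
  · -- The bound is trivial here, as a difference of projections has norm at most two.
    calc _ ≤ ‖V.starProjection‖ + ‖U.starProjection‖ := norm_sub_le _ _
      _ ≤ 1 + 1 := add_le_add V.starProjection_norm_le U.starProjection_norm_le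
      _ ≤ 4 * δ / τ := by rw [le_div_iff₀ hτ]; linarith
  -- The product of the estimated projection with `1 - U.starProjection`.
  have hA : ∀ f ∈ Uᗮ, ‖V.starProjection f‖ ≤ 2 * δ / τ * ‖f‖ := by
    intro f hf
    have h1 : τ / 2 * ‖V.starProjection f‖ ≤ ‖∑ i, (s i * inner ℝ (u i) f) • v i‖ := by
      refine le_of_sq_le_sq ?_ (norm_nonneg _)
      rw [norm_svd_sq hv, mul_pow, hw.starProjection_span_eq_sum, hw.norm_sum_smul_sq,
        Finset.mul_sum]
      calc _ ≤ ∑ i : {i : Fin n // (i : ℕ) < Module.finrank ℝ U},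
            s i ^ 2 * inner ℝ (u i) f ^ 2 := by
            refine Finset.sum_le_sum fun i _ => ?_
            have := sub_le_singularValue hs hs0 hu hv hS hE i i.2
            have : τ / 2 ≤ s i := by linarith
            gcongr
        _ = ∑ i ∈ Finset.univ.map (Function.Embedding.subtype fun i : Fin n =>
              (i : ℕ) < Module.finrank ℝ U), s i ^ 2 * inner ℝ (u i) f ^ 2 := by
            rw [Finset.sum_map]; rfl
        _ ≤ ∑ i, s i ^ 2 * inner ℝ (u i) f ^ 2 :=
            Finset.sum_le_sum_of_subset_of_nonneg (Finset.subset_univ _)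
              fun k _ _ => by positivity
    have h2 := hE f
    rw [hU f hf, sub_zero] at h2
    rw [div_mul_eq_mul_div, le_div_iff₀ hτ]
    linarith
  -- The product of `U.starProjection` with one minus the estimated projection.
  have hB : ∀ f ∈ Vᗮ, ‖U.starProjection f‖ ≤ 2 * δ / τ * ‖f‖ := by
    intro f hf
    have h1 : ‖∑ i, (s i * inner ℝ (u i) f) • v i‖ ≤ δ * ‖f‖ := by
      refine norm_svd_le hs0 hu hv hδ fun i => ?_
      by_cases hi : (i : ℕ) < Module.finrank ℝ U
      · exact Or.inl ((Submodule.mem_orthogonal _ _).1 hf _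
          (Submodule.subset_span ⟨⟨i, hi⟩, rfl⟩))
      · exact Or.inr (singularValue_le hs hs0 hu hv hU hE i (not_lt.1 hi))
    have h2 : S f = S (U.starProjection f) := by
      rw [← sub_eq_zero, ← map_sub]
      exact hU _ (U.sub_starProjection_mem_orthogonal f)
    have h3 := hS _ (U.starProjection_apply_mem f)
    have h4 := norm_sub_norm_le (S f) (∑ i, (s i * inner ℝ (u i) f) • v i)
    rw [norm_sub_rev] at h4
    rw [← h2] at h3
    rw [div_mul_eq_mul_div, le_div_iff₀ hτ]
    linarith [hE f]
  have hU' : ∀ f, ‖f - U.starProjection f‖ ≤ ‖f‖ := fun f => by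
    simpa [Submodule.starProjection_orthogonal_val] using Uᗮ.norm_starProjection_apply_le f
  have hV' : ∀ f, ‖f - V.starProjection f‖ ≤ ‖f‖ := fun f => by
    simpa [Submodule.starProjection_orthogonal_val] using Vᗮ.norm_starProjection_apply_le f
  refine ContinuousLinearMap.opNorm_le_bound _ (by positivity) fun f =>
    norm_le_of_forall_inner_le (by positivity) fun g => ?_
  -- Both products enter after moving the projections across the inner product.
  have key : inner ℝ ((V.starProjection - U.starProjection) f) g =
      inner ℝ (V.starProjection (f - U.starProjection f)) g -
        inner ℝ f (U.starProjection (g - V.starProjection g)) := by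
    rw [← U.inner_starProjection_left_eq_right, inner_sub_right,
      ← V.inner_starProjection_left_eq_right, map_sub, sub_apply,
      inner_sub_left, inner_sub_left]
    ring
  rw [key]
  have h1 := (hA _ (U.sub_starProjection_mem_orthogonal f)).trans
    (mul_le_mul_of_nonneg_left (hU' f) (by positivity))
  have h2 := (hB _ (V.sub_starProjection_mem_orthogonal g)).trans
    (mul_le_mul_of_nonneg_left (hV' g) (by positivity))
  have h3 := (real_inner_le_norm (V.starProjection (f - U.starProjection f)) g).trans
    (mul_le_mul_of_nonneg_right h1 (norm_nonneg g))
  have h4 := (neg_le_of_abs_le (abs_real_inner_le_norm f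
    (U.starProjection (g - V.starProjection g))))
  have h5 := mul_le_mul_of_nonneg_left h2 (norm_nonneg f)
  calc _ ≤ 2 * δ / τ * ‖f‖ * ‖g‖ + ‖f‖ * (2 * δ / τ * ‖g‖) := by linarith
    _ = 4 * δ / τ * ‖f‖ * ‖g‖ := by ring

end SVD

end Hilbert

/-! ### Bilinear forms on `L₂` and their sketches -/

section Forms

variable {d₁ d₂ : ℕ} {Ω₁ : Set (EuclideanSpace ℝ (Fin d₁))} {Ω₂ : Set (EuclideanSpace ℝ (Fin d₂))}

theorem abs_toForm_le (A : L2Prod Ω₁ Ω₂) (u : L2 Ω₁) (v : L2 Ω₂) :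
    |toForm A u v| ≤ ‖A‖ * (‖u‖ * ‖v‖) := by
  rw [toForm_apply, ← norm_tensor]
  exact abs_real_inner_le_norm _ _

theorem toForm_sub (A A' : L2Prod Ω₁ Ω₂) (u : L2 Ω₁) (v : L2 Ω₂) :
    toForm (A - A') u v = toForm A u v - toForm A' u v := by
  simp [toForm_apply, inner_sub_left]

theorem Form.comp_apply (B : Form Ω₁ Ω₂) (P : L2 Ω₁ →L[ℝ] L2 Ω₁) (Q : L2 Ω₂ →L[ℝ] L2 Ω₂)
    (u : L2 Ω₁) (v : L2 Ω₂) : B.comp P Q u v = B (P u) (Q v) := rfl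

theorem Form.opNorm_nonneg {B : Form Ω₁ Ω₂} : 0 ≤ B.opNorm := by
  by_cases h : BddAbove {t : ℝ | ∃ (u : L2 Ω₁) (v : L2 Ω₂), ‖u‖ ≤ 1 ∧ ‖v‖ ≤ 1 ∧ t = B u v}
  · exact le_csSup h ⟨0, 0, by simp, by simp, by simp⟩
  · -- The supremum of an unbounded set of reals is zero by convention.
    exact (Real.sSup_of_not_bddAbove h).ge

variable (M : Submodule ℝ (L2 Ω₁)) (L : Submodule ℝ (L2 Ω₂)) [FiniteDimensional ℝ M]
  [FiniteDimensional ℝ L]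

/-- The set of values in the definition of `Form.opNorm` is bounded for a form restricted to
finite-dimensional spaces, even if the form itself is unbounded. -/
theorem Form.bddAbove_comp_starProjection (B : Form Ω₁ Ω₂) :
    BddAbove {t : ℝ | ∃ (u : L2 Ω₁) (v : L2 Ω₂), ‖u‖ ≤ 1 ∧ ‖v‖ ≤ 1 ∧
      t = B.comp M.starProjection L.starProjection u v} := by
  refine ⟨∑ i, ∑ j, |B (stdOrthonormalBasis ℝ M i : L2 Ω₁) (stdOrthonormalBasis ℝ L j : L2 Ω₂)|,
    ?_⟩
  rintro t ⟨u, v, hu, hv, rfl⟩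
  have hM : ∀ i, |inner ℝ (stdOrthonormalBasis ℝ M i : L2 Ω₁) u| ≤ 1 := fun i => by
    refine (abs_real_inner_le_norm _ _).trans ?_
    have : ‖(stdOrthonormalBasis ℝ M i : L2 Ω₁)‖ = 1 := (stdOrthonormalBasis ℝ M).norm_eq_one i
    rwa [this, one_mul]
  have hL : ∀ i, |inner ℝ (stdOrthonormalBasis ℝ L i : L2 Ω₂) v| ≤ 1 := fun i => by
    refine (abs_real_inner_le_norm _ _).trans ?_
    have : ‖(stdOrthonormalBasis ℝ L i : L2 Ω₂)‖ = 1 := (stdOrthonormalBasis ℝ L).norm_eq_one i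
    rwa [this, one_mul]
  rw [Form.comp_apply, starProjection_eq_sum M, starProjection_eq_sum L, map_sum B,
    LinearMap.sum_apply]
  refine Finset.sum_le_sum fun i _ => ?_
  rw [map_sum]
  refine Finset.sum_le_sum fun j _ => (le_abs_self _).trans ?_
  rw [map_smul, map_smul, LinearMap.smul_apply, smul_eq_mul, smul_eq_mul, abs_mul, abs_mul,
    ← mul_assoc]
  exact mul_le_of_le_one_left (abs_nonneg _) (mul_le_one₀ (hL j) (abs_nonneg _) (hM i))

theorem Form.comp_starProjection_le (B : Form Ω₁ Ω₂) (u : L2 Ω₁) (v : L2 Ω₂) :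
    B.comp M.starProjection L.starProjection u v ≤
      (B.comp M.starProjection L.starProjection).opNorm * (‖u‖ * ‖v‖) := by
  rcases eq_or_ne u 0 with rfl | hu
  · simp
  rcases eq_or_ne v 0 with rfl | hv
  · simp
  have hu' := norm_pos_iff.2 hu
  have hv' := norm_pos_iff.2 hv
  have h := le_csSup (B.bddAbove_comp_starProjection M L)
    ⟨‖u‖⁻¹ • u, ‖v‖⁻¹ • v, by simp [norm_smul, hu'.ne'], by simp [norm_smul, hv'.ne'], rfl⟩
  rw [map_smul, map_smul, LinearMap.smul_apply, smul_eq_mul, smul_eq_mul, ← mul_assoc,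
    ← mul_inv, mul_comm ‖v‖, inv_mul_le_iff₀ (by positivity), mul_comm] at h
  exact h

variable {M L}

/-- The linear map `u ↦ A[u, ·]` from `L₂(Ω₁)` to `L₂(Ω₂)` of `A = ∑ σ_ρ Φ_ρ ⊗ Ψ_ρ`, followed by the
projection onto `L`. -/
noncomputable def partialMap {r : ℕ} (σ : Fin r → ℝ) (Φ : Fin r → L2 Ω₁) (Ψ : Fin r → L2 Ω₂)
    (L : Submodule ℝ (L2 Ω₂)) [FiniteDimensional ℝ L] : L2 Ω₁ →ₗ[ℝ] L2 Ω₂ :=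
  L.starProjection.toLinearMap ∘ₗ
    ∑ ρ, (innerSL ℝ (Φ ρ)).toLinearMap.smulRight (σ ρ • Ψ ρ)

variable {r : ℕ} {σ : Fin r → ℝ} {Φ : Fin r → L2 Ω₁} {Ψ : Fin r → L2 Ω₂}

theorem partialMap_apply (f : L2 Ω₁) :
    partialMap σ Φ Ψ L f = L.starProjection (∑ ρ, (σ ρ * inner ℝ (Φ ρ) f) • Ψ ρ) := by
  simp [partialMap, smul_smul, mul_comm]

theorem inner_sum_smul_eq_toForm (f : L2 Ω₁) (g : L2 Ω₂) :
    inner ℝ (∑ ρ, (σ ρ * inner ℝ (Φ ρ) f) • Ψ ρ) g =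
      toForm (∑ ρ, σ ρ • tensor (Φ ρ) (Ψ ρ)) f g := by
  rw [toForm_apply, sum_inner, sum_inner]
  refine Finset.sum_congr rfl fun ρ _ => ?_
  rw [real_inner_smul_left, real_inner_smul_left, inner_tensor_tensor, mul_assoc]

theorem inner_partialMap (f : L2 Ω₁) (g : L2 Ω₂) :
    inner ℝ (partialMap σ Φ Ψ L f) g =
      toForm (projY (∑ ρ, σ ρ • tensor (Φ ρ) (Ψ ρ)) L) f g := by
  rw [partialMap_apply, Submodule.inner_starProjection_left_eq_right, inner_sum_smul_eq_toForm,
    toForm_projY]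

/-- Sketching in `y` lowers the smallest singular value at most by the bias of the sketch, and it
does not change the range in `x`. -/
theorem le_norm_partialMap (hΦ : Orthonormal ℝ Φ) (hΨ : Orthonormal ℝ Ψ) {σ₀ : ℝ} (h0 : 0 ≤ σ₀)
    (hσ : ∀ ρ, σ₀ ≤ σ ρ) {f : L2 Ω₁} (hf : f ∈ Submodule.span ℝ (Set.range Φ)) :
    (σ₀ - ‖∑ ρ, σ ρ • tensor (Φ ρ) (Ψ ρ) - projY (∑ ρ, σ ρ • tensor (Φ ρ) (Ψ ρ)) L‖) * ‖f‖ ≤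
      ‖partialMap σ Φ Ψ L f‖ := by
  set A : L2Prod Ω₁ Ω₂ := ∑ ρ, σ ρ • tensor (Φ ρ) (Ψ ρ) with hA
  set T := ∑ ρ, (σ ρ * inner ℝ (Φ ρ) f) • Ψ ρ with hT
  have : FiniteDimensional ℝ (Submodule.span ℝ (Set.range Φ)) :=
    FiniteDimensional.span_of_finite ℝ (Set.finite_range Φ)
  have hf' := hΦ.starProjection_span_eq_sum f
  rw [Submodule.starProjection_eq_self_iff.2 hf] at hf'
  have hn : ‖f‖ ^ 2 = ∑ ρ, inner ℝ (Φ ρ) f ^ 2 := by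
    conv_lhs => rw [hf']
    exact hΦ.norm_sum_smul_sq _
  have h1 : σ₀ * ‖f‖ ≤ ‖T‖ := by
    refine le_of_sq_le_sq ?_ (norm_nonneg _)
    rw [hT, norm_svd_sq hΨ, mul_pow, hn, Finset.mul_sum]
    refine Finset.sum_le_sum fun ρ _ => ?_
    have := hσ ρ
    gcongr
  have h2 : ‖T - partialMap σ Φ Ψ L f‖ ≤ ‖A - projY A L‖ * ‖f‖ := by
    refine norm_le_of_forall_inner_le (by positivity) fun g => ?_
    rw [inner_sub_left, inner_partialMap, hT, inner_sum_smul_eq_toForm, ← hA, ← toForm_sub,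
      mul_assoc]
    exact (le_abs_self _).trans (abs_toForm_le _ _ _)
  have h3 := norm_sub_norm_le T (partialMap σ Φ Ψ L f)
  linarith

/-- The deterministic perturbation bound: the estimated projection is as close to the true one as
the deviation of the estimator on `M` and `L`, plus the bias in `x` alone, relative to a lower
bound `τ` for the smallest singular value that remains after sketching in `y`. -/
theorem norm_leadingProjection_sub_le (hΦ : Orthonormal ℝ Φ) (hΨ : Orthonormal ℝ Ψ)
    {A : L2Prod Ω₁ Ω₂} (hA : A = ∑ ρ, σ ρ • tensor (Φ ρ) (Ψ ρ)) {σ₀ τ : ℝ}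
    (hσ : ∀ ρ, σ₀ ≤ σ ρ) (hτ : 0 < τ) (hτA : τ + ‖A - projY A L‖ ≤ σ₀) {Ahat : Form Ω₁ Ω₂}
    {P : L2 Ω₁ →L[ℝ] L2 Ω₁}
    (hP : IsLeadingProjection (Ahat.comp M.starProjection L.starProjection) r P) :
    ‖P - projSpan Φ‖ ≤ 4 * (((Ahat - toForm A).comp M.starProjection L.starProjection).opNorm +
      ‖projY A L - projXY A M L‖) / τ := by
  obtain ⟨n, s, u, v, h, rfl⟩ := hP
  have : FiniteDimensional ℝ (Submodule.span ℝ (Set.range Φ)) :=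
    FiniteDimensional.span_of_finite ℝ (Set.finite_range Φ)
  have : FiniteDimensional ℝ
      (Submodule.span ℝ (Set.range fun i : {i : Fin n // (i : ℕ) < r} => u i)) :=
    FiniteDimensional.span_of_finite ℝ (Set.finite_range _)
  have hσ₀ : 0 ≤ σ₀ := by linarith [norm_nonneg (A - projY A L)]
  have := Form.opNorm_nonneg (B := (Ahat - toForm A).comp M.starProjection L.starProjection)
  refine norm_starProjection_span_sub_le (U := Submodule.span ℝ (Set.range Φ))
    (S := partialMap σ Φ Ψ L) h.antitone h.nonneg h.orthonormal_left h.orthonormal_right ?_ hτ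
    (by positivity) ?_ ?_ (by rw [finrank_span_eq_card hΦ.linearIndependent, Fintype.card_fin])
  · intro f hf
    have hf0 : ∀ ρ, inner ℝ (Φ ρ) f = 0 := fun ρ =>
      (Submodule.mem_orthogonal _ _).1 hf _ (Submodule.subset_span (Set.mem_range_self ρ))
    simp [partialMap_apply, hf0]
  · intro f hf
    refine le_trans ?_ (le_norm_partialMap hΦ hΨ hσ₀ hσ hf)
    rw [← hA]
    exact mul_le_mul_of_nonneg_right (by linarith) (norm_nonneg f)
  · intro f
    refine norm_le_of_forall_inner_le (by positivity) fun g => ?_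
    -- The error form splits into the deviation and the bias in `x`.
    have key : inner ℝ (∑ i, (s i * inner ℝ (u i) f) • v i - partialMap σ Φ Ψ L f) g =
        (Ahat - toForm A).comp M.starProjection L.starProjection f g -
          toForm (projY A L - projXY A M L) f g := by
      have h1 : inner ℝ (∑ i, (s i * inner ℝ (u i) f) • v i) g =
          Ahat.comp M.starProjection L.starProjection f g := by
        rw [h.eq_sum, sum_inner]
        exact Finset.sum_congr rfl fun i _ => by rw [real_inner_smul_left, mul_assoc]
      rw [inner_sub_left, h1, inner_partialMap, ← hA, toForm_sub, toForm_projXY,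
        Form.comp_apply, Form.comp_apply, LinearMap.sub_apply, LinearMap.sub_apply]
      ring
    rw [key]
    have h1 := (Ahat - toForm A).comp_starProjection_le M L f g
    have h2 := neg_le_of_abs_le (abs_toForm_le (projY A L - projXY A M L) f g)
    linarith

end Forms

/-! ### Stochastic order and the rate -/

theorem IsBigOP.of_eventually {Ξ : ℕ → Type*} [∀ N, MeasurableSpace (Ξ N)]
    {P : ∀ N, Measure (Ξ N)} {X Y : ∀ N, Ξ N → ℝ} {a b : ℕ → ℝ} (hX : IsBigOP P X a)
    (h : ∀ K : ℝ, 0 < K → ∃ K' : ℝ, 0 < K' ∧ ∀ᶠ N in atTop, ∀ ω,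
      |X N ω / a N| < K → |Y N ω / b N| < K') : IsBigOP P Y b := by
  intro ε hε
  obtain ⟨K, hK, hlim⟩ := hX ε hε
  obtain ⟨K', hK', hev⟩ := h K hK
  refine ⟨K', hK', lt_of_le_of_lt (limsup_le_limsup ?_) hlim⟩
  filter_upwards [hev] with N hN
  exact measure_mono fun ω hω => not_lt.1 fun hlt => (hN ω hlt).not_ge hω

theorem theorem2 (B : ℝ) (hB : 0 < B) :
    ∃ C : ℝ, 0 < C ∧
      ∀ (d₁ d₂ : ℕ) (_ : 0 < d₁) (_ : 0 < d₂)
        (Ω₁ : Set (EuclideanSpace ℝ (Fin d₁))) (_ : MeasurableSet Ω₁)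
        (Ω₂ : Set (EuclideanSpace ℝ (Fin d₂))) (_ : MeasurableSet Ω₂)
        (α : ℝ) (_ : 1 ≤ α)
        -- the population functions, of finite rank, with their singular value decompositions
        (A : ℕ → L2Prod Ω₁ Ω₂) (r : ℕ → ℕ) (hr : ∀ N, 0 < r N)
        (σ : ∀ N, Fin (r N) → ℝ) (Φ : ∀ N, Fin (r N) → L2 Ω₁) (Ψ : ∀ N, Fin (r N) → L2 Ω₂)
        (_ : ∀ N, Antitone (σ N)) (_ : ∀ N ρ, 0 < σ N ρ)
        (_ : ∀ N, Orthonormal ℝ (Φ N)) (_ : ∀ N, Orthonormal ℝ (Ψ N))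
        (_ : ∀ N, A N = ∑ ρ, σ N ρ • tensor (Φ N ρ) (Ψ N ρ))
        (σr : ℕ → ℝ) (_ : ∀ N, σr N = σ N ⟨r N - 1, Nat.sub_one_lt (Nat.ne_of_gt (hr N))⟩)
        -- the estimation and sketching spaces
        (m l : ℕ → ℕ) (_ : ∀ N, 0 < m N) (_ : ∀ N, 0 < l N)
        (M : ℕ → Submodule ℝ (L2 Ω₁)) (L : ℕ → Submodule ℝ (L2 Ω₂))
        [∀ N, FiniteDimensional ℝ (M N)] [∀ N, FiniteDimensional ℝ (L N)]
        (_ : ∀ N, Module.finrank ℝ (M N) = m N ^ d₁) (_ : ∀ N, Module.finrank ℝ (L N) = l N ^ d₂)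
        -- the bias bounds, with implied constant `B`
        (_ : IsBigOWith B atTop (fun N => ‖A N - projXY (A N) (M N) (L N)‖ ^ 2)
          (fun N => (m N : ℝ) ^ (-(2 * α)) + (l N : ℝ) ^ (-(2 * α))))
        (_ : IsBigOWith B atTop (fun N => ‖A N - projY (A N) (L N)‖ ^ 2)
          (fun N => (l N : ℝ) ^ (-(2 * α))))
        (_ : IsBigOWith B atTop (fun N => ‖projY (A N) (L N) - projXY (A N) (M N) (L N)‖ ^ 2)
          (fun N => (m N : ℝ) ^ (-(2 * α))))
        -- the estimator from a sample of size `N`, given by its random values `Ahat[u, v]`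
        -- (a random function in `L₂(Ω₁ × Ω₂)` or, say, an empirical measure), and its deviation
        (Ξ : ℕ → Type*) [∀ N, MeasurableSpace (Ξ N)]
        (P : ∀ N, Measure (Ξ N)) [∀ N, IsProbabilityMeasure (P N)]
        (Ahat : ∀ N, Ξ N → Form Ω₁ Ω₂)
        (_ : IsBigOP P
          (fun N ω => ((Ahat N ω - toForm (A N)).comp
            (M N).starProjection (L N).starProjection).opNorm)
          (fun N => √((Module.finrank ℝ (M N) + Module.finrank ℝ (L N)) / N)))
        -- the signal strength
        (_ : ∀ᶠ N : ℕ in atTop, C * max (max ((l N : ℝ) ^ (-α)) ((m N : ℝ) ^ (-α)))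
          √(((m N : ℝ) ^ d₁ + (l N : ℝ) ^ d₂) / N) < σr N)
        -- the estimated projection
        (Phat : ∀ N, Ξ N → L2 Ω₁ →L[ℝ] L2 Ω₁)
        (_ : ∀ N ω, IsLeadingProjection
          ((Ahat N ω).comp (M N).starProjection (L N).starProjection) (r N) (Phat N ω)),
        IsBigOP P (fun N ω => ‖Phat N ω - projSpan (Φ N)‖ ^ 2)
          (fun N => (σr N) ^ (-2 : ℤ) *
            (((m N : ℝ) ^ d₁ + (l N : ℝ) ^ d₂) / N + (m N : ℝ) ^ (-(2 * α)))) := by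
  refine ⟨2 * √B, by positivity, ?_⟩
  intro d₁ d₂ _ _ Ω₁ _ Ω₂ _ α _ A r hr σ Φ Ψ hanti hpos hΦ hΨ hA σr hσr m l hm hl M L _ _
    hMdim hLdim _ hbiasY hbiasX Ξ _ P _ Ahat hdev hsig Phat hPhat
  refine hdev.of_eventually fun K hK => ⟨128 * (K ^ 2 + B) + 1, by positivity, ?_⟩
  filter_upwards [hbiasY.bound, hbiasX.bound, hsig, eventually_gt_atTop 0] with N hY hX hs hN ω hω
  have hmN : (0 : ℝ) < m N := by exact_mod_cast hm N
  have hlN : (0 : ℝ) < l N := by exact_mod_cast hl N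
  have hNN : (0 : ℝ) < N := by exact_mod_cast hN
  have hrpow : ∀ x : ℝ, 0 < x → x ^ (-(2 * α)) = (x ^ (-α)) ^ 2 := fun x hx => by
    rw [← Real.rpow_natCast, ← Real.rpow_mul hx.le]
    congr 1
    push_cast
    ring
  have hσN : 0 < σr N := by
    rw [hσr]
    exact hpos _ _
  have hσmin : ∀ ρ, σr N ≤ σ N ρ := fun ρ => by
    rw [hσr]
    exact hanti N (Nat.le_sub_one_of_lt ρ.2)
  -- The constant `2 * √B` makes the bias in `y` at most half of the smallest singular value.
  have hbY : ‖A N - projY (A N) (L N)‖ ≤ σr N / 2 := by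
    rw [hrpow _ hlN, norm_pow, norm_pow, norm_norm, Real.norm_eq_abs, sq_abs] at hY
    have h1 : ‖A N - projY (A N) (L N)‖ ≤ √B * (l N : ℝ) ^ (-α) := by
      refine le_of_sq_le_sq ?_ (by positivity)
      rwa [mul_pow, Real.sq_sqrt hB.le]
    have h2 : 2 * √B * (l N : ℝ) ^ (-α) < σr N :=
      lt_of_le_of_lt (mul_le_mul_of_nonneg_left ((le_max_left _ _).trans (le_max_left _ _))
        (by positivity)) hs
    linarith
  have hbX : ‖projY (A N) (L N) - projXY (A N) (M N) (L N)‖ ^ 2 ≤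
      B * (m N : ℝ) ^ (-(2 * α)) := by
    have h0 : (0 : ℝ) ≤ (m N : ℝ) ^ (-(2 * α)) := by positivity
    rwa [norm_pow, norm_norm, Real.norm_eq_abs, abs_of_nonneg h0] at hX
  have hmain := norm_leadingProjection_sub_le (hΦ N) (hΨ N) (hA N) hσmin (half_pos hσN)
    (by linarith) (hPhat N ω)
  set x := ((Ahat N ω - toForm (A N)).comp (M N).starProjection (L N).starProjection).opNorm
  set y := ‖projY (A N) (L N) - projXY (A N) (M N) (L N)‖
  set D := ((m N : ℝ) ^ d₁ + (l N : ℝ) ^ d₂) / N with hD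
  set Q := (m N : ℝ) ^ (-(2 * α)) with hQ
  have hD0 : 0 < D := by positivity
  have hQ0 : 0 < Q := by positivity
  have hx0 : 0 ≤ x := Form.opNorm_nonneg
  have hx : x ^ 2 ≤ K ^ 2 * D := by
    rw [hMdim, hLdim] at hω
    push_cast at hω
    rw [← hD, abs_of_nonneg (by positivity), div_lt_iff₀ (by positivity)] at hω
    calc x ^ 2 ≤ (K * √D) ^ 2 := by gcongr
      _ = K ^ 2 * D := by rw [mul_pow, Real.sq_sqrt hD0.le]
  rw [abs_of_nonneg (by positivity), div_lt_iff₀ (by positivity), zpow_neg, zpow_ofNat,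
    ← mul_assoc, mul_comm _ (_⁻¹), mul_assoc, lt_inv_mul_iff₀ (by positivity), ← mul_pow]
  rw [le_div_iff₀ (by positivity)] at hmain
  calc (σr N * ‖Phat N ω - projSpan (Φ N)‖) ^ 2 ≤ (8 * (x + y)) ^ 2 :=
        pow_le_pow_left₀ (by positivity) (by linarith) 2
    _ ≤ 128 * (x ^ 2 + y ^ 2) := by linarith [sq_nonneg (x - y)]
    _ ≤ 128 * (K ^ 2 * D + B * Q) := by linarith
    _ < (128 * (K ^ 2 + B) + 1) * (D + Q) := by
        have h1 : 0 < K ^ 2 * Q := by positivity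
        have h2 : 0 < B * D := by positivity
        linarith
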